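/- Let $s\in[0,1]$, let $p,q\ge 0$ and $r\in(0,1)$ with $p+q+r=1$, and put $\beta:=1-r\in(0,1)$. Let $(m_n)_{n\ge1}$ be integers with $1\le m_n\le n$, $m_n\to\infty$ and $\gamma_n:=m_n/n\to\gamma$ (so $\gamma\in[0,1]$). Elephant random walk with stops: let $X_1$ equal $+1$ with probability $s$ and $-1$ with probability $1-s$; for $n\ge1$ let $X_{n+1}=\varepsilon_n X_{U_n}$, where $U_n$ is uniform over $\{1,\dots,n\}$ and $\varepsilon_n$ equals $1,-1,0$ with probabilities $p,q,r$. Triangular array: for $n\ge 1$ let $X^{(n)}_k=X_k$ if $1\le k\le m_n$, and $X^{(n)}_k=\varepsilon_{k,n}X_{U_{k,n}}$ if $m_n<k\le n$, where $U_{k,n}$ is uniform over $\{1,\dots,m_n\}$ and $\varepsilon_{k,n}$ equals $1,-1,0$ with probabilities $p,q,r$. All the variables $X_1$, $U_n$, $\varepsilon_n$ ($n\ge1$), $U_{k,n}$, $\varepsilon_{k,n}$ ($n\ge 1$, $m_n<k\le n$) are independent. Let $$\Sigma_n:=\sum_{k=1}^n X_k^2,\qquad \Xi_n:=\sum_{k=1}^n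 \bigl(X^{(n)}_k\bigr)^2$$ be the numbers of moves. Then $\Sigma_n/n^{\beta}$ converges, almost surely and in $L^2$, to a square-integrable random variable $\Sigma$, and $$\lim_{n\to\infty}\frac{\gamma_n\,\Xi_n}{(m_n)^{\beta}}=\{\gamma+\beta(1-\gamma)\}\,\Sigma\qquad\text{in } L^2 .$$ -/

import Mathlib

open MeasureTheory ProbabilityTheory Filter Topology

namespace ERWStops

/-- The sources of randomness of an elephant random walk with stops together with its
triangular array.
* `first` is the first step `X₁`;
* `pick n` is the uniform time `U_n` used for the step `X_{n+1}`, and `coin n` is the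
  multiplier in `{1, -1, 0}` (keep the remembered step, reverse it, or stop) used for it;
* `rowPick n k` is the uniform time `U_{k,n}` used for the entry `X_k^{(n)}` of the `n`-th row
  and `rowCoin n k` is the multiplier used for it. -/
structure Drivers (Ω : Type*) where
  first : Ω → ℤ
  pick : ℕ → Ω → ℕ
  coin : ℕ → Ω → ℤ
  rowPick : ℕ → ℕ → Ω → ℕ
  rowCoin : ℕ → ℕ → Ω → ℤ

/-- Labels for all the random variables in `Drivers`. -/
inductive Label where
  | first : Label
  | pick (n : ℕ) : Label
  | coin (n : ℕ) : Label
  | rowPick (n k : ℕ) : Label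
  | rowCoin (n k : ℕ) : Label

variable {Ω : Type*}

/-- All the sources of randomness as a single family of integer-valued random variables
(the uniform times are viewed in `ℤ` through `ℕ ⊆ ℤ`, which generates the same σ-algebras). -/
def Drivers.family (D : Drivers Ω) : Label → Ω → ℤ
  | .first => D.first
  | .pick n => fun ω => (D.pick n ω : ℤ)
  | .coin n => D.coin n
  | .rowPick n k => fun ω => (D.rowPick n k ω : ℤ)
  | .rowCoin n k => D.rowCoin n k

/-- `u` is uniformly distributed over `{1, …, N}`. -/
def IsUniform [MeasurableSpace Ω] (μ : Measure Ω) (N : ℕ) (u : Ω → ℕ) : Prop :=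
  ∀ i ∈ Finset.Icc 1 N, μ.real {ω | u ω = i} = 1 / (N : ℝ)

/-- `e` takes the values `1`, `-1`, `0` with probabilities `p`, `q`, `r`. -/
def IsCoin [MeasurableSpace Ω] (μ : Measure Ω) (p q r : ℝ) (e : Ω → ℤ) : Prop :=
  μ.real {ω | e ω = 1} = p ∧ μ.real {ω | e ω = -1} = q ∧ μ.real {ω | e ω = 0} = r

/-- The joint law of the sources of randomness: they are all independent, the first step is
`+1` with probability `s` and `-1` with probability `1 - s`, the time `U_n` is uniform over
`{1, …, n}`, the time `U_{k,n}`, `m n < k ≤ n`, is uniform over `{1, …, m n}`, and the multipliers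
are `1`, `-1`, `0` with probabilities `p`, `q`, `r`. -/
structure Drivers.HasLaw [MeasurableSpace Ω] (D : Drivers Ω) (μ : Measure Ω)
    (s p q r : ℝ) (m : ℕ → ℕ) : Prop where
  measurable : ∀ i, Measurable (D.family i)
  indep : iIndepFun D.family μ
  first_pos : μ.real {ω | D.first ω = 1} = s
  first_neg : μ.real {ω | D.first ω = -1} = 1 - s
  pick_law : ∀ n, 1 ≤ n → IsUniform μ n (D.pick n)
  coin_law : ∀ n, 1 ≤ n → IsCoin μ p q r (D.coin n)
  rowPick_law : ∀ n k, 1 ≤ n → m n < k → k ≤ n → IsUniform μ (m n) (D.rowPick n k)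
  rowCoin_law : ∀ n k, 1 ≤ n → m n < k → k ≤ n → IsCoin μ p q r (D.rowCoin n k)

/-- The steps of the elephant random walk with stops: `X_1` is the given first step and
`X_{n+1} = (n-th multiplier) * X_{U_n}` for `n ≥ 1`. (`X_0 = 0` is a dummy value. The minimum with
`n` only serves the recursion: `U_n ≤ n` almost surely.) -/
def Drivers.step (D : Drivers Ω) (ω : Ω) : ℕ → ℤ
  | 0 => 0
  | 1 => D.first ω
  | n + 2 => D.coin (n + 1) ω * Drivers.step D ω (min (D.pick (n + 1) ω) (n + 1))
termination_by n => n
decreasing_by omega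

/-- The `k`-th entry of the `n`-th row of the triangular array: it is `X_k` for `k ≤ m n`, and
for `m n < k ≤ n` it is the multiplier times `X_{U_{k,n}}`. -/
def Drivers.rowStep (D : Drivers Ω) (m : ℕ → ℕ) (n : ℕ) (ω : Ω) (k : ℕ) : ℤ :=
  if k ≤ m n then D.step ω k else D.rowCoin n k ω * D.step ω (D.rowPick n k ω)

/-- `Σ_n`, the number of moves of the elephant random walk with stops up to time `n`. -/
def Drivers.moves (D : Drivers Ω) (n : ℕ) (ω : Ω) : ℤ :=
  ∑ k ∈ Finset.Icc 1 n, D.step ω k ^ 2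

/-- `Ξ_n`, the number of moves in the `n`-th row of the triangular array. -/
def Drivers.rowMoves (D : Drivers Ω) (m : ℕ → ℕ) (n : ℕ) (ω : Ω) : ℤ :=
  ∑ k ∈ Finset.Icc 1 n, D.rowStep m n ω k ^ 2

/-- Convergence in `L²(μ)` of a sequence of real random variables. -/
def TendstoInL2 [MeasurableSpace Ω] (μ : Measure Ω) (f : ℕ → Ω → ℝ) (g : Ω → ℝ) : Prop :=
  (∀ n, MemLp (f n) 2 μ) ∧ MemLp g 2 μ ∧
    Tendsto (fun n => eLpNorm (fun ω => f n ω - g ω) 2 μ) atTop (𝓝 0)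

end ERWStops

/-! Given the past, step `n + 1` is a move with conditional probability `β Σ_n / n`, since it copies
a uniformly chosen earlier step and is kept nonzero with probability `β = 1 - r`. Hence `Σ_n`
divided by its mean, the product of the factors `1 + β / k` for `k < n`, is a martingale
(`martingale_normMoves`). A recursion for the second moment, using that the square of an indicator
is itself, bounds this martingale in `L²` (`integral_moves_sq_le`). It therefore converges almost
surely, and in `L²` because its increments are orthogonal (`tendstoInL2_of_orthogonal`). The mean is
of order `n ^ β` by Euler's limit for the Gamma function (`growth_tendsto`), which turns this into
convergence of `Σ_n / n ^ β`.

For the array, each entry beyond `m n` is a move with conditional probability `β Σ_{m n} / m n`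
given the walk. So `Ξ_n` is `(1 + β (n - m n) / m n) Σ_{m n}` plus a sum of centred, pairwise
orthogonal fluctuations (`rowMoves_eq`). After normalization the first term has the required limit,
and the fluctuations have second moment of order `(m n) ^ (-β)` (`tendsto_rowError`). -/

namespace ERWStops

variable {Ω : Type*}

/-! ### Measurability of the walk with respect to its sources of randomness -/

/-- The σ-algebra generated by the sources of randomness with labels in `T`. -/
abbrev Drivers.sigma (D : Drivers Ω) (T : Set Label) : MeasurableSpace Ω :=
  ⨆ i ∈ T, MeasurableSpace.comap (D.family i) ⊤

lemma Drivers.sigma_mono (D : Drivers Ω) {T T' : Set Label} (h : T ⊆ T') :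
    D.sigma T ≤ D.sigma T' := biSup_mono h

lemma Drivers.measurable_family (D : Drivers Ω) {T : Set Label} {i : Label} (hi : i ∈ T) :
    Measurable[D.sigma T] (D.family i) :=
  Measurable.mono (comap_measurable (D.family i))
    (le_biSup (fun i => MeasurableSpace.comap (D.family i) ⊤) hi) le_rfl

/-- The indicator of a move at time `k`. -/
def Drivers.moved (D : Drivers Ω) (k : ℕ) (ω : Ω) : ℝ := (D.step ω k : ℝ) ^ 2

lemma Drivers.moves_eq (D : Drivers Ω) (n : ℕ) (ω : Ω) :
    (D.moves n ω : ℝ) = ∑ k ∈ Finset.Icc 1 n, D.moved k ω := by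
  simp [Drivers.moves, Drivers.moved]

lemma Drivers.moves_succ (D : Drivers Ω) (n : ℕ) (ω : Ω) :
    (D.moves (n + 1) ω : ℝ) = D.moves n ω + D.moved (n + 1) ω := by
  rw [moves_eq, moves_eq, Finset.sum_Icc_succ_top (by omega)]

/-- The labels of the sources of randomness that determine the first `n` steps. -/
def past (n : ℕ) : Set Label :=
  {l | l = .first ∨ ∃ k < n, l = .pick k ∨ l = .coin k}

lemma past_mono : Monotone past := by
  rintro a b hab l (h | ⟨k, hk, h⟩)
  · exact Or.inl h
  · exact Or.inr ⟨k, hk.trans_le hab, h⟩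

lemma Drivers.measurable_step (D : Drivers Ω) (n : ℕ) : ∀ k ≤ n,
    Measurable[D.sigma (past n)] fun ω => D.step ω k := by
  intro k
  induction k using Nat.strong_induction_on with
  | _ k ih =>
    intro hkn
    match k with
    | 0 => simp only [Drivers.step]; exact measurable_const
    | 1 =>
      simp only [Drivers.step]
      exact D.measurable_family (i := .first) (Or.inl rfl)
    | k + 2 =>
      -- The random index is resolved into a finite sum over its possible values, so that the
      -- induction hypothesis applies term by term.
      have h : (fun ω => D.step ω (k + 2)) = fun ω => D.coin (k + 1) ω *
          ∑ i ∈ Finset.range (k + 2),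
            (if min (D.pick (k + 1) ω : ℤ) (k + 1) = i then 1 else 0) * D.step ω i := by
        ext ω
        have : ∀ i : ℕ, (min (D.pick (k + 1) ω : ℤ) (k + 1) = i) ↔
            min (D.pick (k + 1) ω) (k + 1) = i := by intro i; omega
        simp [Drivers.step, this]
      rw [h]
      have hc : Measurable[D.sigma (past n)] (D.coin (k + 1)) :=
        D.measurable_family (i := .coin (k + 1)) (Or.inr ⟨k + 1, by omega, Or.inr rfl⟩)
      have hp : Measurable[D.sigma (past n)] fun ω => (D.pick (k + 1) ω : ℤ) :=
        D.measurable_family (i := .pick (k + 1)) (Or.inr ⟨k + 1, by omega, Or.inl rfl⟩)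
      refine Measurable.mul hc (Finset.measurable_fun_sum _ fun i hi => ?_)
      have hi' := Finset.mem_range.1 hi
      refine Measurable.mul ?_ (ih i hi' (by omega))
      exact (measurable_of_countable
        fun x : ℤ => if min x (k + 1) = (i : ℤ) then (1 : ℤ) else 0).comp hp

lemma Drivers.measurable_moved (D : Drivers Ω) {n k : ℕ} (hk : k ≤ n) :
    Measurable[D.sigma (past n)] (D.moved k) :=
  (measurable_of_countable fun x : ℤ => (x : ℝ) ^ 2).comp (D.measurable_step n k hk)

lemma Drivers.measurable_moves (D : Drivers Ω) (n : ℕ) :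
    Measurable[D.sigma (past n)] fun ω => (D.moves n ω : ℝ) := by
  simp_rw [D.moves_eq]
  exact Finset.measurable_fun_sum _ fun k hk => D.measurable_moved (Finset.mem_Icc.1 hk).2

/-! ### Almost sure values and moments of the uniform times and multipliers -/

variable [MeasurableSpace Ω] {μ : Measure Ω}

/-- The laws only prescribe the masses of the listed values; as these exhaust the total mass, no
other value occurs. -/
lemma ae_mem_of_sum_measureReal_eq_one [IsProbabilityMeasure μ] {α : Type*} [MeasurableSpace α]
    [MeasurableSingletonClass α] {f : Ω → α} (hf : Measurable f) (t : Finset α)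
    (h : ∑ i ∈ t, μ.real {ω | f ω = i} = 1) : ∀ᵐ ω ∂μ, f ω ∈ t := by
  have hmeas : ∀ i, MeasurableSet {ω | f ω = i} := fun i => hf (measurableSet_singleton i)
  have h1 : μ.real {ω | f ω ∈ t} = 1 := by
    rw [← h, ← measureReal_biUnion_finset]
    · congr 1
      ext ω
      simp
    · intro i _ j _ hij
      exact Set.disjoint_left.2 fun ω hi hj => hij (hi.symm.trans hj)
    · exact fun i _ => hmeas i
  have h2 : MeasurableSet {ω | f ω ∈ t} := hf t.measurableSet
  rw [ae_iff]
  refine (prob_compl_eq_zero_iff (μ := μ) h2).2 ?_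
  rw [measureReal_def] at h1
  exact (ENNReal.toReal_eq_one_iff _).1 h1

lemma IsUniform.ae_mem [IsProbabilityMeasure μ] {N : ℕ} {u : Ω → ℕ} (h : IsUniform μ N u)
    (hu : Measurable u) (hN : 1 ≤ N) : ∀ᵐ ω ∂μ, u ω ∈ Finset.Icc 1 N := by
  refine ae_mem_of_sum_measureReal_eq_one hu _ ?_
  rw [Finset.sum_congr rfl h]
  have : (N : ℝ) ≠ 0 := by positivity
  simp [this]

lemma IsCoin.ae_mem [IsProbabilityMeasure μ] {p q r : ℝ} {e : Ω → ℤ} (h : IsCoin μ p q r e)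
    (he : Measurable e) (hpqr : p + q + r = 1) : ∀ᵐ ω ∂μ, e ω = 1 ∨ e ω = -1 ∨ e ω = 0 := by
  have := ae_mem_of_sum_measureReal_eq_one (μ := μ) he {1, -1, 0} (by
    simp [h.1, h.2.1, h.2.2]; linarith)
  simpa using this

lemma IsCoin.integral_sq [IsProbabilityMeasure μ] {p q r : ℝ} {e : Ω → ℤ} (h : IsCoin μ p q r e)
    (he : Measurable e) (hpqr : p + q + r = 1) : ∫ ω, (e ω : ℝ) ^ 2 ∂μ = 1 - r := by
  have hmeas : ∀ i, MeasurableSet {ω | e ω = i} := fun i => he (measurableSet_singleton i)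
  have h1 : (fun ω => (e ω : ℝ) ^ 2) =ᵐ[μ]
      fun ω => {ω | e ω = 1}.indicator 1 ω + {ω | e ω = -1}.indicator 1 ω := by
    filter_upwards [h.ae_mem he hpqr] with ω hω
    rcases hω with hω | hω | hω <;> simp [hω, Set.indicator]
  rw [integral_congr_ae h1, integral_add, integral_indicator_one (hmeas _),
    integral_indicator_one (hmeas _), h.1, h.2.1]
  · linarith
  · exact (integrable_const 1).indicator (hmeas _)
  · exact (integrable_const 1).indicator (hmeas _)

/-! ### Conditional probability of a move -/

section law

variable {D : Drivers Ω} {s p q r : ℝ} {m : ℕ → ℕ}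

lemma Drivers.HasLaw.sigma_le (hD : D.HasLaw μ s p q r m) (T : Set Label) :
    D.sigma T ≤ ‹MeasurableSpace Ω› :=
  iSup₂_le fun i _ => (hD.measurable i).comap_le

lemma Drivers.HasLaw.indepFun (hD : D.HasLaw μ s p q r m) {T T' : Set Label}
    (hT : Disjoint T T') {V W : Ω → ℝ} (hV : Measurable[D.sigma T] V)
    (hW : Measurable[D.sigma T'] W) : IndepFun V W μ := by
  rw [IndepFun_iff_Indep]
  exact indep_of_indep_of_le_left (indep_of_indep_of_le_right
    (indep_iSup_of_disjoint (fun i => (hD.measurable i).comap_le) hD.indep.iIndep hT)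
    hW.comap_le) hV.comap_le

/-- Averaging out a uniform time and a multiplier that are independent of everything else. -/
lemma Drivers.HasLaw.integral_mul_recall [IsProbabilityMeasure μ] (hD : D.HasLaw μ s p q r m)
    (hpqr : p + q + r = 1)
    {T : Set Label} {i j : Label} (hi : i ∉ T) (hj : j ∉ T) (hij : i ≠ j) {u : Ω → ℕ} {e : Ω → ℤ}
    (hu : D.family i = fun ω => (u ω : ℤ)) (he : D.family j = e) {N : ℕ} (hN : 1 ≤ N)
    (hun : IsUniform μ N u) (hco : IsCoin μ p q r e) {V : ℕ → Ω → ℝ} {W : Ω → ℝ}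
    (hV : ∀ k ∈ Finset.Icc 1 N, Measurable[D.sigma T] (V k))
    (hVb : ∀ k ∈ Finset.Icc 1 N, MemLp (V k) ⊤ μ)
    (hW : Measurable[D.sigma T] W) (hWb : MemLp W ⊤ μ) :
    ∫ ω, W ω * ((e ω : ℝ) ^ 2 * V (u ω) ω) ∂μ =
      (1 - r) / N * ∫ ω, W ω * ∑ k ∈ Finset.Icc 1 N, V k ω ∂μ := by
  have hcast : Measurable (fun x : ℤ => (x : ℝ) ^ 2) := measurable_of_countable _
  have heM : Measurable e := he ▸ hD.measurable j
  have huZ : Measurable fun ω => (u ω : ℤ) := hu ▸ hD.measurable i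
  have huM : Measurable u := by
    have : u = fun ω => ((u ω : ℤ)).toNat := by ext; simp
    rw [this]
    exact (measurable_of_countable Int.toNat).comp huZ
  have hind : ∀ k : ℕ, Measurable (fun x : ℤ => if x = (k : ℤ) then (1 : ℝ) else 0) :=
    fun k => measurable_of_countable _
  have hprob : ∀ k ∈ Finset.Icc 1 N,
      ∫ ω, (if (u ω : ℤ) = (k : ℤ) then (1 : ℝ) else 0) * (e ω : ℝ) ^ 2 ∂μ = (1 - r) / N := by
    intro k hk
    have hI : IndepFun (fun ω => if (u ω : ℤ) = (k : ℤ) then (1 : ℝ) else 0)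
        (fun ω => (e ω : ℝ) ^ 2) μ := by
      refine hD.indepFun (T := {i}) (T' := {j}) (by simpa using hij) ?_ ?_
      · have := (hind k).comp (D.measurable_family (T := {i}) rfl)
        rwa [hu] at this
      · have := hcast.comp (D.measurable_family (T := {j}) rfl)
        rwa [he] at this
    rw [hI.integral_fun_mul_eq_mul_integral ((hind k).comp huZ).aestronglyMeasurable
      (hcast.comp heM).aestronglyMeasurable, hco.integral_sq heM hpqr]
    have : (fun ω => if (u ω : ℤ) = (k : ℤ) then (1 : ℝ) else 0) =
        {ω | u ω = k}.indicator 1 := by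
      ext ω
      simp [Set.indicator]
    have hset : MeasurableSet {ω | u ω = k} := huM (measurableSet_singleton k)
    rw [this, integral_indicator_one hset, hun k hk]
    ring
  -- On the event `u = k` the integrand splits into a factor depending on `T` and a factor depending
  -- on `{i, j}`, which are independent.
  have hkey : ∀ k ∈ Finset.Icc 1 N,
      ∫ ω, (W ω * V k ω) * ((if (u ω : ℤ) = (k : ℤ) then (1 : ℝ) else 0) * (e ω : ℝ) ^ 2) ∂μ =
        (1 - r) / N * ∫ ω, W ω * V k ω ∂μ := by
    intro k hk
    have hWV : Measurable[D.sigma T] fun ω => W ω * V k ω := Measurable.mul hW (hV k hk)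
    have hR : Measurable[D.sigma {i, j}]
        fun ω => (if (u ω : ℤ) = (k : ℤ) then (1 : ℝ) else 0) * (e ω : ℝ) ^ 2 := by
      have h1 := (hind k).comp (D.measurable_family (T := {i, j}) (i := i) (by simp))
      have h2 := hcast.comp (D.measurable_family (T := {i, j}) (i := j) (by simp))
      rw [hu] at h1
      rw [he] at h2
      exact Measurable.mul h1 h2
    have hI := hD.indepFun (T := T) (T' := {i, j}) (by simp [hi, hj]) hWV hR
    rw [hI.integral_fun_mul_eq_mul_integral
      (hWV.mono (hD.sigma_le _) le_rfl).aestronglyMeasurable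
      (hR.mono (hD.sigma_le _) le_rfl).aestronglyMeasurable, hprob k hk]
    ring
  have hWV : ∀ k ∈ Finset.Icc 1 N, MemLp (fun ω => W ω * V k ω) ⊤ μ :=
    fun k hk => (hVb k hk).mul' hWb
  have hRb : ∀ k : ℕ, MemLp
      (fun ω => (if (u ω : ℤ) = (k : ℤ) then (1 : ℝ) else 0) * (e ω : ℝ) ^ 2) ⊤ μ := by
    intro k
    refine MemLp.of_bound (((hind k).comp huZ).mul (hcast.comp heM)).aestronglyMeasurable 1 ?_
    filter_upwards [hco.ae_mem heM hpqr] with ω hω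
    rcases hω with hω | hω | hω <;> simp [hω] <;> split_ifs <;> simp
  have hcongr : (fun ω => W ω * ((e ω : ℝ) ^ 2 * V (u ω) ω)) =ᵐ[μ] fun ω =>
      ∑ k ∈ Finset.Icc 1 N,
        (W ω * V k ω) * ((if (u ω : ℤ) = (k : ℤ) then (1 : ℝ) else 0) * (e ω : ℝ) ^ 2) := by
    filter_upwards [hun.ae_mem huM hN] with ω hω
    rw [Finset.sum_eq_single_of_mem (u ω) hω]
    · simp; ring
    · intro k _ hk
      simp [hk.symm]
  rw [integral_congr_ae hcongr, integral_finsetSum, Finset.sum_congr rfl hkey]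
  · simp_rw [Finset.mul_sum]
    rw [integral_finsetSum, Finset.mul_sum]
    exact fun k hk => (hWV k hk).integrable le_top
  · exact fun k hk => ((hRb k).mul' (hWV k hk)).integrable le_top

lemma Drivers.HasLaw.measurable_pick (hD : D.HasLaw μ s p q r m) (n : ℕ) :
    Measurable (D.pick n) := by
  have : D.pick n = fun ω => (D.family (.pick n) ω).toNat := by ext; simp [Drivers.family]
  rw [this]
  exact (measurable_of_countable Int.toNat).comp (hD.measurable _)

variable [IsProbabilityMeasure μ]

lemma Drivers.HasLaw.ae_first (hD : D.HasLaw μ s p q r m) :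
    ∀ᵐ ω ∂μ, D.first ω = 1 ∨ D.first ω = -1 := by
  have := ae_mem_of_sum_measureReal_eq_one (μ := μ) (hD.measurable .first) {1, -1} (by
    simp [Drivers.family, hD.first_pos, hD.first_neg])
  simpa [Drivers.family] using this

lemma Drivers.HasLaw.ae_moved_mem (hD : D.HasLaw μ s p q r m) (hpqr : p + q + r = 1) :
    ∀ᵐ ω ∂μ, ∀ k, D.moved k ω = 0 ∨ D.moved k ω = 1 := by
  have hc : ∀ᵐ ω ∂μ, ∀ n, 1 ≤ n → D.coin n ω = 1 ∨ D.coin n ω = -1 ∨ D.coin n ω = 0 := by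
    rw [ae_all_iff]
    intro n
    rw [eventually_imp_distrib_left]
    exact fun hn => (hD.coin_law n hn).ae_mem (hD.measurable (.coin n)) hpqr
  filter_upwards [hc, hD.ae_first] with ω hω h1 k
  induction k using Nat.strong_induction_on with
  | _ k ih =>
    match k with
    | 0 => left; simp [Drivers.moved, Drivers.step]
    | 1 => right; rcases h1 with h1 | h1 <;> simp [Drivers.moved, Drivers.step, h1]
    | k + 2 =>
      have h2 := ih (min (D.pick (k + 1) ω) (k + 1)) (by omega)
      rw [Drivers.moved] at h2 ⊢
      rw [Drivers.step]
      push_cast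
      rw [mul_pow]
      rcases hω (k + 1) (by omega) with h | h | h
      · simpa only [h, Int.cast_one, one_pow, one_mul] using h2
      · simpa only [h, Int.cast_neg, Int.cast_one, neg_sq, one_pow, one_mul] using h2
      · simp [h]

lemma Drivers.HasLaw.ae_moved_succ (hD : D.HasLaw μ s p q r m) {n : ℕ} (hn : 1 ≤ n) :
    ∀ᵐ ω ∂μ, D.moved (n + 1) ω = (D.coin n ω : ℝ) ^ 2 * D.moved (D.pick n ω) ω := by
  filter_upwards [(hD.pick_law n hn).ae_mem (hD.measurable_pick n) hn] with ω hω
  obtain ⟨k, rfl⟩ := Nat.exists_eq_add_of_le' hn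
  rw [Drivers.moved, Drivers.step, min_eq_left (Finset.mem_Icc.1 hω).2]
  push_cast
  rw [mul_pow, Drivers.moved]

lemma Drivers.HasLaw.memLp_moved (hD : D.HasLaw μ s p q r m) (hpqr : p + q + r = 1) (k : ℕ) :
    MemLp (D.moved k) ⊤ μ := by
  refine MemLp.of_bound
    ((D.measurable_moved le_rfl).mono (hD.sigma_le _) le_rfl).aestronglyMeasurable 1 ?_
  filter_upwards [hD.ae_moved_mem hpqr] with ω hω
  rcases hω k with h | h <;> simp [h]

lemma Drivers.HasLaw.memLp_moves (hD : D.HasLaw μ s p q r m) (hpqr : p + q + r = 1) (n : ℕ) :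
    MemLp (fun ω => (D.moves n ω : ℝ)) ⊤ μ := by
  simp_rw [D.moves_eq]
  exact memLp_finsetSum _ fun k _ => hD.memLp_moved hpqr k

lemma Drivers.HasLaw.ae_moves_one (hD : D.HasLaw μ s p q r m) :
    ∀ᵐ ω ∂μ, (D.moves 1 ω : ℝ) = 1 := by
  filter_upwards [hD.ae_first] with ω hω
  rw [D.moves_eq]
  rcases hω with h | h <;> simp [Drivers.moved, Drivers.step, h]

/-- The conditional expectation of the next move given the past, tested against bounded
past-measurable `W`. This form serves both the martingale property (`W` an indicator) and the moment
recursions (`W` equal to `1` or to `Σ_n`). -/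
lemma Drivers.HasLaw.integral_mul_moved_succ (hD : D.HasLaw μ s p q r m) (hpqr : p + q + r = 1)
    {n : ℕ} (hn : 1 ≤ n) {W : Ω → ℝ} (hW : Measurable[D.sigma (past n)] W)
    (hWb : MemLp W ⊤ μ) :
    ∫ ω, W ω * D.moved (n + 1) ω ∂μ = (1 - r) / n * ∫ ω, W ω * D.moves n ω ∂μ := by
  simp_rw [D.moves_eq]
  rw [← hD.integral_mul_recall hpqr (T := past n) (i := .pick n) (j := .coin n)
    (by simp [past]) (by simp [past]) (by simp) rfl rfl hn (hD.pick_law n hn) (hD.coin_law n hn)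
    (fun k hk => D.measurable_moved (Finset.mem_Icc.1 hk).2) (fun k _ => hD.memLp_moved hpqr k)
    hW hWb]
  refine integral_congr_ae ?_
  filter_upwards [hD.ae_moved_succ hn] with ω hω
  rw [hω]
  rfl

lemma Drivers.HasLaw.integral_mul_moves_succ (hD : D.HasLaw μ s p q r m) (hpqr : p + q + r = 1)
    {n : ℕ} (hn : 1 ≤ n) {W : Ω → ℝ} (hW : Measurable[D.sigma (past n)] W)
    (hWb : MemLp W ⊤ μ) :
    ∫ ω, W ω * D.moves (n + 1) ω ∂μ = (1 + (1 - r) / n) * ∫ ω, W ω * D.moves n ω ∂μ := by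
  simp_rw [D.moves_succ, mul_add]
  rw [integral_add, hD.integral_mul_moved_succ hpqr hn hW hWb]
  · ring
  · exact ((hD.memLp_moves hpqr n).mul' hWb).integrable le_top
  · exact ((hD.memLp_moved hpqr (n + 1)).mul' hWb).integrable le_top

/-! ### First and second moments of the number of moves -/

/-- The expected number of moves up to time `n + 1`, for a walk that moves with probability `β`. -/
noncomputable def growth (β : ℝ) (n : ℕ) : ℝ := ∏ k ∈ Finset.range n, (1 + β / ((k + 1 : ℕ) : ℝ))

lemma growth_succ (β : ℝ) (n : ℕ) :
    growth β (n + 1) = growth β n * (1 + β / ((n + 1 : ℕ) : ℝ)) := Finset.prod_range_succ _ _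

lemma growth_pos {β : ℝ} (hβ : 0 ≤ β) (n : ℕ) : 0 < growth β n :=
  Finset.prod_pos fun _ _ => by positivity

/-- Up to the factor `β * n!`, the product is the denominator of Euler's sequence `Real.GammaSeq β
n`, so `growth β n / n ^ β` is the inverse of `β * Real.GammaSeq β n`. Passing from `n ^ β` to `(n +
1) ^ β` costs one factor `1 + β / (n + 1)`, which tends to `1`. -/
lemma growth_tendsto {β : ℝ} (hβ : 0 < β) :
    Tendsto (fun n : ℕ => growth β n / ((n + 1 : ℕ) : ℝ) ^ β) atTop
      (𝓝 (1 / (β * Real.Gamma β))) := by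
  have hG := Real.Gamma_pos_of_pos hβ
  have hprod : ∀ n : ℕ, ∏ j ∈ Finset.range (n + 1), (β + j) = β * n.factorial * growth β n := by
    intro n
    induction n with
    | zero => simp [growth]
    | succ n ih =>
      rw [Finset.prod_range_succ, ih, growth_succ, Nat.factorial_succ]
      push_cast
      field_simp
      ring
  have h1 : Tendsto (fun n : ℕ => growth β n / (n : ℝ) ^ β) atTop
      (𝓝 (1 / (β * Real.Gamma β))) := by
    have h := ((Real.GammaSeq_tendsto_Gamma β).const_mul β).inv₀ (by positivity)
    rw [← one_div] at h
    refine h.congr' ?_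
    filter_upwards with n
    have hf : (n.factorial : ℝ) ≠ 0 := by positivity
    have hg := (growth_pos hβ.le n).ne'
    rw [Real.GammaSeq, hprod]
    field_simp
  have h2 : Tendsto (fun n : ℕ => 1 + β / ((n + 1 : ℕ) : ℝ)) atTop (𝓝 1) := by
    have := (tendsto_const_div_atTop_nhds_zero_nat β).comp (tendsto_add_atTop_nat 1)
    simpa using this.const_add 1
  have h3 := (h1.comp (tendsto_add_atTop_nat 1)).div h2 one_ne_zero
  rw [div_one] at h3
  refine h3.congr fun n => ?_
  have : 1 + β / ((n + 1 : ℕ) : ℝ) ≠ 0 := by positivity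
  simp only [Pi.div_apply, Function.comp_apply, growth_succ]
  field_simp

lemma Drivers.HasLaw.integral_moves (hD : D.HasLaw μ s p q r m) (hpqr : p + q + r = 1) (n : ℕ) :
    ∫ ω, (D.moves (n + 1) ω : ℝ) ∂μ = growth (1 - r) n := by
  induction n with
  | zero =>
    rw [integral_congr_ae hD.ae_moves_one]
    simp [growth]
  | succ n ih =>
    have := hD.integral_mul_moves_succ hpqr (n := n + 1) (by omega) (W := fun _ => 1)
      measurable_const (memLp_const 1)
    simp only [one_mul] at this
    rw [this, ih, growth_succ]
    ring

lemma Drivers.HasLaw.integral_moves_sq_le (hD : D.HasLaw μ s p q r m) (hpqr : p + q + r = 1)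
    (hr1 : r ≤ 1) (n : ℕ) :
    ∫ ω, (D.moves (n + 1) ω : ℝ) ^ 2 ∂μ ≤ 2 * growth (1 - r) n ^ 2 := by
  -- With `v` the second moment, `a` the mean and `b = β / (n + 1)`, the step sends `v` to `(1 + 2b)
  -- v + b a` and `a` to `(1 + b) a`. Hence `v + a` is multiplied by exactly `1 + 2b ≤ (1 + b)²`,
  -- and the induction closes; it starts from equality, `1 + 1 = 2`.
  suffices h : ∫ ω, (D.moves (n + 1) ω : ℝ) ^ 2 ∂μ + growth (1 - r) n ≤
      2 * growth (1 - r) n ^ 2 by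
    linarith [growth_pos (sub_nonneg.2 hr1) n]
  induction n with
  | zero =>
    have : ∀ᵐ ω ∂μ, (D.moves 1 ω : ℝ) ^ 2 = 1 := hD.ae_moves_one.mono fun ω h => by simp [h]
    rw [integral_congr_ae this]
    norm_num [growth]
  | succ n ih =>
    have hM := hD.memLp_moves hpqr
    have hm := hD.memLp_moved hpqr
    have hsq : ∫ ω, (D.moves (n + 1 + 1) ω : ℝ) ^ 2 ∂μ =
        ∫ ω, (D.moves (n + 1) ω : ℝ) ^ 2 ∂μ +
          2 * ∫ ω, (D.moves (n + 1) ω : ℝ) * D.moved (n + 1 + 1) ω ∂μ +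
          ∫ ω, 1 * D.moved (n + 1 + 1) ω ∂μ := by
      have i1 : Integrable (fun ω => (D.moves (n + 1) ω : ℝ) ^ 2) μ := by
        simpa only [sq] using ((hM (n + 1)).mul' (hM (n + 1)) (r := ⊤)).integrable le_top
      have i2 : Integrable (fun ω => 2 * ((D.moves (n + 1) ω : ℝ) * D.moved (n + 1 + 1) ω)) μ :=
        (((hm (n + 1 + 1)).mul' (hM (n + 1)) (r := ⊤)).integrable le_top).const_mul 2
      have i3 : Integrable (fun ω => 1 * D.moved (n + 1 + 1) ω) μ :=
        ((hm _).integrable le_top).const_mul 1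
      have i12 : Integrable (fun ω => (D.moves (n + 1) ω : ℝ) ^ 2 +
          2 * ((D.moves (n + 1) ω : ℝ) * D.moved (n + 1 + 1) ω)) μ := i1.add i2
      rw [← integral_const_mul, ← integral_add i1 i2, ← integral_add i12 i3]
      refine integral_congr_ae ?_
      filter_upwards [hD.ae_moved_mem hpqr] with ω hω
      rw [D.moves_succ (n + 1)]
      rcases hω (n + 1 + 1) with h | h <;> simp only [h] <;> ring
    have e1 := hD.integral_mul_moved_succ hpqr (n := n + 1) (by omega)
      (D.measurable_moves (n + 1)) (hM (n + 1))
    have e2 := hD.integral_mul_moved_succ hpqr (n := n + 1) (by omega) (W := fun _ => 1)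
      measurable_const (memLp_const 1)
    simp only [← sq] at e1
    simp only [one_mul] at e2 hsq
    rw [hD.integral_moves hpqr] at e2
    rw [hsq, e1, e2, growth_succ]
    have hβ : 0 ≤ (1 - r) / ((n + 1 : ℕ) : ℝ) := div_nonneg (sub_nonneg.2 hr1) (by positivity)
    set b := (1 - r) / ((n + 1 : ℕ) : ℝ)
    set v := ∫ ω, (D.moves (n + 1) ω : ℝ) ^ 2 ∂μ
    set a := growth (1 - r) n
    nlinarith [mul_le_mul_of_nonneg_left ih (by positivity : 0 ≤ 1 + 2 * b), sq_nonneg (a * b)]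

end law

/-! ### Convergence in `L²` -/

lemma eLpNorm_two_eq {f : Ω → ℝ} (hf : MemLp f 2 μ) :
    eLpNorm f 2 μ = ENNReal.ofReal √(∫ ω, f ω ^ 2 ∂μ) := by
  rw [hf.eLpNorm_eq_integral_rpow_norm (by simp) (by simp), Real.sqrt_eq_rpow]
  simp

lemma tendstoInL2_of_integral_sq {f : ℕ → Ω → ℝ} {g : Ω → ℝ} (hf : ∀ n, MemLp (f n) 2 μ)
    (hg : MemLp g 2 μ)
    (h : Tendsto (fun n => ∫ ω, (f n ω - g ω) ^ 2 ∂μ) atTop (𝓝 0)) : TendstoInL2 μ f g := by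
  refine ⟨hf, hg, ?_⟩
  have he : ∀ n, eLpNorm (fun ω => f n ω - g ω) 2 μ =
      ENNReal.ofReal √(∫ ω, (f n ω - g ω) ^ 2 ∂μ) := fun n => eLpNorm_two_eq ((hf n).sub hg)
  simp_rw [he]
  simpa using ENNReal.tendsto_ofReal h.sqrt

lemma TendstoInL2.const_mul {f : ℕ → Ω → ℝ} {g : Ω → ℝ} (h : TendstoInL2 μ f g) {c : ℕ → ℝ}
    {d : ℝ} (hc : Tendsto c atTop (𝓝 d)) :
    TendstoInL2 μ (fun n ω => c n * f n ω) (fun ω => d * g ω) := by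
  refine ⟨fun n => (h.1 n).const_mul _, h.2.1.const_mul _, ?_⟩
  have hb : ∀ n, eLpNorm (fun ω => c n * f n ω - d * g ω) 2 μ ≤
      ‖c n‖ₑ * eLpNorm (fun ω => f n ω - g ω) 2 μ + ‖c n - d‖ₑ * eLpNorm g 2 μ := by
    intro n
    have : (fun ω => c n * f n ω - d * g ω) =
        c n • (fun ω => f n ω - g ω) + (c n - d) • g := by
      ext ω; simp; ring
    rw [this, ← eLpNorm_const_smul, ← eLpNorm_const_smul]
    exact eLpNorm_add_le (((h.1 n).sub h.2.1).aestronglyMeasurable.const_smul _)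
      (h.2.1.aestronglyMeasurable.const_smul _) one_le_two
  have h1 : Tendsto (fun n => ‖c n‖ₑ * eLpNorm (fun ω => f n ω - g ω) 2 μ) atTop (𝓝 0) := by
    simpa using ENNReal.Tendsto.mul hc.enorm (Or.inr ENNReal.zero_ne_top) h.2.2
      (Or.inr enorm_ne_top)
  have h2 : Tendsto (fun n => ‖c n - d‖ₑ * eLpNorm g 2 μ) atTop (𝓝 0) := by
    have : Tendsto (fun n => ‖c n - d‖ₑ) atTop (𝓝 0) := by
      simpa using (hc.sub_const d).enorm
    simpa using ENNReal.Tendsto.mul_const this (Or.inr h.2.1.eLpNorm_ne_top)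
  exact tendsto_of_tendsto_of_tendsto_of_le_of_le tendsto_const_nhds
    (by simpa using h1.add h2) (fun _ => zero_le) hb

lemma TendstoInL2.add {f f' : ℕ → Ω → ℝ} {g g' : Ω → ℝ} (h : TendstoInL2 μ f g)
    (h' : TendstoInL2 μ f' g') :
    TendstoInL2 μ (fun n ω => f n ω + f' n ω) (fun ω => g ω + g' ω) := by
  refine ⟨fun n => (h.1 n).add (h'.1 n), h.2.1.add h'.2.1, ?_⟩
  refine tendsto_of_tendsto_of_tendsto_of_le_of_le tendsto_const_nhds
    (by simpa using h.2.2.add h'.2.2) (fun _ => zero_le) fun n => ?_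
  have : (fun ω => f n ω + f' n ω - (g ω + g' ω)) =
      (fun ω => f n ω - g ω) + fun ω => f' n ω - g' ω := by
    ext ω; simp; ring
  rw [this]
  exact eLpNorm_add_le ((h.1 n).sub h.2.1).aestronglyMeasurable
    ((h'.1 n).sub h'.2.1).aestronglyMeasurable one_le_two

lemma TendstoInL2.comp {f : ℕ → Ω → ℝ} {g : Ω → ℝ} (h : TendstoInL2 μ f g) {k : ℕ → ℕ}
    (hk : Tendsto k atTop atTop) : TendstoInL2 μ (fun n => f (k n)) g :=
  ⟨fun n => h.1 (k n), h.2.1, h.2.2.comp hk⟩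

/-- An `L²`-bounded sequence with orthogonal increments that converges almost everywhere
converges in `L²`. -/
lemma tendstoInL2_of_orthogonal {M : ℕ → Ω → ℝ} {S : Ω → ℝ} (hM : ∀ n, MemLp (M n) 2 μ)
    (horth : ∀ k n, k ≤ n → ∫ ω, M k ω * M n ω ∂μ = ∫ ω, M k ω ^ 2 ∂μ) {C : ℝ}
    (hC : ∀ n, ∫ ω, M n ω ^ 2 ∂μ ≤ C)
    (hS : ∀ᵐ ω ∂μ, Tendsto (fun n => M n ω) atTop (𝓝 (S ω))) : TendstoInL2 μ M S := by
  set v : ℕ → ℝ := fun n => ∫ ω, M n ω ^ 2 ∂μ with hv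
  -- Pythagoras: second moments increase and stay bounded, so increments are eventually small.
  have hinc : ∀ k n, k ≤ n → ∫ ω, (M n ω - M k ω) ^ 2 ∂μ = v n - v k := by
    intro k n hkn
    have i1 := (hM n).integrable_sq
    have i2 : Integrable (fun ω => 2 * (M k ω * M n ω)) μ :=
      ((hM k).integrable_mul (hM n)).const_mul 2
    have i3 := (hM k).integrable_sq
    have : ∀ ω, (M n ω - M k ω) ^ 2 = M n ω ^ 2 - 2 * (M k ω * M n ω) + M k ω ^ 2 :=
      fun ω => by ring
    simp_rw [this]
    have i12 : Integrable (fun ω => M n ω ^ 2 - 2 * (M k ω * M n ω)) μ := i1.sub i2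
    rw [integral_add i12 i3, integral_sub i1 i2, integral_const_mul, horth k n hkn]
    simp only [hv]
    ring
  have hmono : Monotone v := fun k n hkn => by
    have : 0 ≤ ∫ ω, (M n ω - M k ω) ^ 2 ∂μ := integral_nonneg fun _ => sq_nonneg _
    linarith [hinc k n hkn]
  have hbdd : BddAbove (Set.range v) := ⟨C, by rintro _ ⟨n, rfl⟩; exact hC n⟩
  have hlim := tendsto_atTop_ciSup hmono hbdd
  set V := ⨆ n, v n
  -- Fatou's lemma, letting `n → ∞` in the increment from `k` to `n`.
  have hle : ∀ k, eLpNorm (fun ω => S ω - M k ω) 2 μ ≤ ENNReal.ofReal √(V - v k) := by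
    intro k
    refine Lp.eLpNorm_le_of_ae_tendsto (u := atTop) (f := fun n ω => M n ω - M k ω) ?_
      (fun n => ((hM n).sub (hM k)).aestronglyMeasurable) ?_
    · filter_upwards [eventually_ge_atTop k] with n hn
      have hsub : MemLp (fun ω => M n ω - M k ω) 2 μ := (hM n).sub (hM k)
      rw [eLpNorm_two_eq hsub, hinc k n hn]
      gcongr
      exact le_ciSup hbdd n
    · filter_upwards [hS] with ω hω
      exact hω.sub_const _
  have hSm : AEStronglyMeasurable S μ :=
    aestronglyMeasurable_of_tendsto_ae atTop (fun n => (hM n).aestronglyMeasurable) hS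
  have hS2 : MemLp S 2 μ := by
    have : MemLp (fun ω => S ω - M 0 ω) 2 μ :=
      ⟨hSm.sub (hM 0).aestronglyMeasurable, (hle 0).trans_lt ENNReal.ofReal_lt_top⟩
    convert this.add (hM 0) using 1
    ext ω
    simp
  refine ⟨hM, hS2, tendsto_of_tendsto_of_tendsto_of_le_of_le tendsto_const_nhds ?_
    (fun _ => zero_le) (h := fun k => ENNReal.ofReal √(V - v k)) fun k => ?_⟩
  · simpa using ENNReal.tendsto_ofReal ((hlim.const_sub V).sqrt)
  · have := hle k
    rw [← eLpNorm_neg] at this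
    simpa [Pi.neg_def] using this

/-! ### The martingale of normalized moves and its limit -/

variable {D : Drivers Ω} {s p q r : ℝ} {m : ℕ → ℕ}

/-- The filtration generated by the steps of the walk, started at time `1`. -/
def Drivers.HasLaw.filtration (hD : D.HasLaw μ s p q r m) :
    Filtration ℕ ‹MeasurableSpace Ω› where
  seq n := D.sigma (past (n + 1))
  mono' _ _ h := D.sigma_mono (past_mono (Nat.succ_le_succ h))
  le' _ := hD.sigma_le _

/-- The number of moves divided by its expectation. -/
noncomputable def Drivers.normMoves (D : Drivers Ω) (β : ℝ) (n : ℕ) (ω : Ω) : ℝ :=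
  (growth β n)⁻¹ * D.moves (n + 1) ω

variable [IsProbabilityMeasure μ]

lemma Drivers.HasLaw.memLp_normMoves (hD : D.HasLaw μ s p q r m) (hpqr : p + q + r = 1) (n : ℕ) :
    MemLp (D.normMoves (1 - r) n) ⊤ μ := (hD.memLp_moves hpqr (n + 1)).const_mul _

omit [MeasurableSpace Ω] in
lemma Drivers.measurable_normMoves (D : Drivers Ω) (β : ℝ) (n : ℕ) :
    Measurable[D.sigma (past (n + 1))] (D.normMoves β n) :=
  Measurable.const_mul (D.measurable_moves (n + 1)) _

lemma Drivers.HasLaw.integral_mul_normMoves_succ (hD : D.HasLaw μ s p q r m)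
    (hpqr : p + q + r = 1) (hr1 : r ≤ 1) {n : ℕ} {W : Ω → ℝ}
    (hW : Measurable[D.sigma (past (n + 1))] W) (hWb : MemLp W ⊤ μ) :
    ∫ ω, W ω * D.normMoves (1 - r) (n + 1) ω ∂μ = ∫ ω, W ω * D.normMoves (1 - r) n ω ∂μ := by
  have h := hD.integral_mul_moves_succ hpqr (n := n + 1) (by omega) hW hWb
  have hβ : 1 + (1 - r) / ((n + 1 : ℕ) : ℝ) ≠ 0 := by
    have : 0 ≤ (1 - r) / ((n + 1 : ℕ) : ℝ) := div_nonneg (sub_nonneg.2 hr1) (by positivity)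
    positivity
  simp only [Drivers.normMoves, mul_left_comm (W _)]
  rw [integral_const_mul, integral_const_mul, h, growth_succ, mul_inv, mul_assoc,
    inv_mul_cancel_left₀ hβ]

lemma Drivers.HasLaw.martingale_normMoves (hD : D.HasLaw μ s p q r m) (hpqr : p + q + r = 1)
    (hr1 : r ≤ 1) : Martingale (D.normMoves (1 - r)) hD.filtration μ := by
  refine martingale_of_setIntegral_eq_succ
    (fun n => (D.measurable_normMoves _ n).stronglyMeasurable)
    (fun n => (hD.memLp_normMoves hpqr n).integrable le_top) fun n t ht => ?_
  have ht' : MeasurableSet t := hD.filtration.le n t ht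
  have hW : Measurable[D.sigma (past (n + 1))] (t.indicator fun _ => (1 : ℝ)) :=
    Measurable.indicator measurable_const ht
  have h := hD.integral_mul_normMoves_succ hpqr hr1 hW ((memLp_const 1).indicator ht')
  rw [← integral_indicator ht', ← integral_indicator ht']
  simpa only [← Set.indicator_mul_left, one_mul] using h.symm

lemma Drivers.HasLaw.integral_normMoves_mul (hD : D.HasLaw μ s p q r m) (hpqr : p + q + r = 1)
    (hr1 : r ≤ 1) {k n : ℕ} (hkn : k ≤ n) :
    ∫ ω, D.normMoves (1 - r) k ω * D.normMoves (1 - r) n ω ∂μ =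
      ∫ ω, D.normMoves (1 - r) k ω ^ 2 ∂μ := by
  induction n, hkn using Nat.le_induction with
  | base => simp only [sq]
  | succ n hkn ih =>
    rw [hD.integral_mul_normMoves_succ hpqr hr1 _ (hD.memLp_normMoves hpqr k), ih]
    exact (D.measurable_normMoves _ k).mono
      (D.sigma_mono (past_mono (Nat.succ_le_succ hkn))) le_rfl

lemma Drivers.HasLaw.integral_normMoves_sq_le (hD : D.HasLaw μ s p q r m) (hpqr : p + q + r = 1)
    (hr1 : r ≤ 1) (n : ℕ) : ∫ ω, D.normMoves (1 - r) n ω ^ 2 ∂μ ≤ 2 := by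
  have h := hD.integral_moves_sq_le hpqr hr1 n
  have hg := growth_pos (sub_nonneg.2 hr1) n
  simp only [Drivers.normMoves, mul_pow]
  rw [integral_const_mul, inv_pow, inv_mul_le_iff₀ (by positivity)]
  linarith

lemma Drivers.HasLaw.exists_tendsto_normMoves (hD : D.HasLaw μ s p q r m) (hpqr : p + q + r = 1)
    (hr1 : r ≤ 1) : ∃ S : Ω → ℝ,
      (∀ᵐ ω ∂μ, Tendsto (fun n => D.normMoves (1 - r) n ω) atTop (𝓝 (S ω))) ∧
      TendstoInL2 μ (D.normMoves (1 - r)) S := by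
  have h2 : ∀ n, MemLp (D.normMoves (1 - r) n) 2 μ :=
    fun n => (hD.memLp_normMoves hpqr n).mono_exponent le_top
  -- The `L¹` norms are at most the `L²` norms, hence at most `√2`.
  have hlim := (hD.martingale_normMoves hpqr hr1).submartingale.exists_ae_tendsto_of_bdd
    (R := (√2).toNNReal) fun n => by
      refine (eLpNorm_le_eLpNorm_of_exponent_le one_le_two (h2 n).1).trans ?_
      rw [eLpNorm_two_eq (h2 n)]
      exact ENNReal.ofReal_le_ofReal (Real.sqrt_le_sqrt (hD.integral_normMoves_sq_le hpqr hr1 n))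
  obtain ⟨S, -, hS⟩ := measurable_limit_of_tendsto_metrizable_ae
    (fun n => (h2 n).aestronglyMeasurable.aemeasurable) hlim
  exact ⟨S, hS, tendstoInL2_of_orthogonal h2
    (fun k n hkn => hD.integral_normMoves_mul hpqr hr1 hkn)
    (hD.integral_normMoves_sq_le hpqr hr1) hS⟩

lemma Drivers.HasLaw.exists_tendsto_moves (hD : D.HasLaw μ s p q r m) (hpqr : p + q + r = 1)
    (hr1 : r < 1) : ∃ S : Ω → ℝ,
      (∀ᵐ ω ∂μ, Tendsto (fun n : ℕ => (D.moves n ω : ℝ) / (n : ℝ) ^ (1 - r)) atTop (𝓝 (S ω))) ∧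
      TendstoInL2 μ (fun n ω => (D.moves n ω : ℝ) / (n : ℝ) ^ (1 - r)) S := by
  obtain ⟨S, hae, hL2⟩ := hD.exists_tendsto_normMoves hpqr hr1.le
  have hg := growth_tendsto (sub_pos.2 hr1)
  have heq : ∀ (n : ℕ) (ω : Ω), growth (1 - r) n / ((n + 1 : ℕ) : ℝ) ^ (1 - r) *
      D.normMoves (1 - r) n ω = D.moves (n + 1) ω / ((n + 1 : ℕ) : ℝ) ^ (1 - r) := by
    intro n ω
    have := (growth_pos (sub_pos.2 hr1).le n).ne'
    rw [Drivers.normMoves]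
    field_simp
  refine ⟨fun ω => 1 / ((1 - r) * Real.Gamma (1 - r)) * S ω, ?_, fun n => ?_, ?_, ?_⟩
  · filter_upwards [hae] with ω hω
    rw [← tendsto_add_atTop_iff_nat 1]
    exact (hg.mul hω).congr fun n => heq n ω
  · simp_rw [div_eq_inv_mul]
    exact ((hD.memLp_moves hpqr n).const_mul _).mono_exponent le_top
  · exact (hL2.const_mul hg).2.1
  · rw [← tendsto_add_atTop_iff_nat 1]
    refine (hL2.const_mul hg).2.2.congr fun n => ?_
    simp_rw [heq]

/-! ### Fluctuations of the triangular array -/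

section row

-- The σ-algebra is an explicit parameter so that the sub-σ-algebras `D.sigma T` can be used.
omit [MeasurableSpace Ω] in
lemma measurable_eval_nat {_ : MeasurableSpace Ω} {f : ℕ → Ω → ℝ} (hf : ∀ i, Measurable (f i))
    {u : Ω → ℕ} (hu : Measurable u) : Measurable fun ω => f (u ω) ω := by
  have h : Measurable fun x : Ω × ℕ => f x.2 x.1 := measurable_from_prod_countable_left hf
  exact h.comp (measurable_id.prodMk hu)

/-- The fluctuation of the `k`-th entry of the `n`-th row of the triangular array around its
conditional expectation given the walk. -/
noncomputable def Drivers.rowFluct (D : Drivers Ω) (m : ℕ → ℕ) (β : ℝ) (n k : ℕ) (ω : Ω) : ℝ :=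
  (D.rowStep m n ω k : ℝ) ^ 2 - β / m n * D.moves (m n) ω

variable {n k : ℕ}

omit [MeasurableSpace Ω] in
lemma Drivers.rowStep_sq (D : Drivers Ω) (hk : m n < k) (ω : Ω) :
    (D.rowStep m n ω k : ℝ) ^ 2 =
      (D.rowCoin n k ω : ℝ) ^ 2 * D.moved (D.rowPick n k ω) ω := by
  rw [Drivers.rowStep, if_neg (by omega)]
  push_cast
  rw [mul_pow, Drivers.moved]

/-- All labels except the two that are used for the `k`-th entry of the `n`-th row. -/
def awayFrom (n k : ℕ) : Set Label := {l | l ≠ .rowPick n k ∧ l ≠ .rowCoin n k}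

lemma past_subset_awayFrom (j n k : ℕ) : past j ⊆ awayFrom n k := by
  rintro l (rfl | ⟨i, _, rfl | rfl⟩) <;> simp [awayFrom]

-- The set `T` is left free: all labels are used for integrability, and those of `awayFrom` for
-- orthogonality with another entry of the row.
omit [MeasurableSpace Ω] in
lemma Drivers.measurable_rowStep_sq (D : Drivers Ω) {T : Set Label} (hT : ∀ j, past j ⊆ T)
    (hp : .rowPick n k ∈ T) (hc : .rowCoin n k ∈ T) (hk : m n < k) :
    Measurable[D.sigma T] fun ω => (D.rowStep m n ω k : ℝ) ^ 2 := by
  rw [funext (D.rowStep_sq hk)]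
  refine Measurable.mul ((measurable_of_countable fun x : ℤ => (x : ℝ) ^ 2).comp
    (D.measurable_family hc)) ?_
  have hpM : Measurable[D.sigma T] (D.rowPick n k) := by
    have h := (measurable_of_countable Int.toNat).comp (D.measurable_family hp)
    exact h
  exact measurable_eval_nat (fun i =>
    (D.measurable_moved (le_refl i)).mono (D.sigma_mono (hT i)) le_rfl) hpM

lemma Drivers.HasLaw.ae_rowStep_sq (hD : D.HasLaw μ s p q r m) (hpqr : p + q + r = 1)
    (hn : 1 ≤ n) (hk : m n < k) (hkn : k ≤ n) :
    ∀ᵐ ω ∂μ, (D.rowStep m n ω k : ℝ) ^ 2 = 0 ∨ (D.rowStep m n ω k : ℝ) ^ 2 = 1 := by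
  filter_upwards [hD.ae_moved_mem hpqr,
    (hD.rowCoin_law n k hn hk hkn).ae_mem (hD.measurable (.rowCoin n k)) hpqr] with ω h1 h2
  rw [D.rowStep_sq hk]
  rcases h1 (D.rowPick n k ω) with h | h <;> rcases h2 with h' | h' | h' <;> simp [h, h']

lemma Drivers.HasLaw.memLp_rowStep_sq (hD : D.HasLaw μ s p q r m) (hpqr : p + q + r = 1)
    (hn : 1 ≤ n) (hk : m n < k) (hkn : k ≤ n) :
    MemLp (fun ω => (D.rowStep m n ω k : ℝ) ^ 2) ⊤ μ := by
  refine MemLp.of_bound (Measurable.aestronglyMeasurable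
    ((D.measurable_rowStep_sq (fun _ => Set.subset_univ _) trivial trivial hk).mono
      (hD.sigma_le _) le_rfl)) 1 ?_
  filter_upwards [hD.ae_rowStep_sq hpqr hn hk hkn] with ω h
  rcases h with h | h <;> simp [h]

lemma Drivers.HasLaw.memLp_rowFluct (hD : D.HasLaw μ s p q r m) (hpqr : p + q + r = 1)
    (hn : 1 ≤ n) (hk : m n < k) (hkn : k ≤ n) (β : ℝ) : MemLp (D.rowFluct m β n k) ⊤ μ :=
  (hD.memLp_rowStep_sq hpqr hn hk hkn).sub ((hD.memLp_moves hpqr (m n)).const_mul _)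

lemma Drivers.HasLaw.integral_mul_rowFluct (hD : D.HasLaw μ s p q r m) (hpqr : p + q + r = 1)
    (hn : 1 ≤ n) (hmn : 1 ≤ m n) (hk : m n < k) (hkn : k ≤ n) {W : Ω → ℝ}
    (hW : Measurable[D.sigma (awayFrom n k)] W) (hWb : MemLp W ⊤ μ) :
    ∫ ω, W ω * D.rowFluct m (1 - r) n k ω ∂μ = 0 := by
  have i1 : Integrable (fun ω => W ω * (D.rowStep m n ω k : ℝ) ^ 2) μ :=
    ((hD.memLp_rowStep_sq hpqr hn hk hkn).mul' hWb (r := ⊤)).integrable le_top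
  have i2 : Integrable (fun ω => W ω * (D.moves (m n) ω : ℝ)) μ :=
    ((hD.memLp_moves hpqr (m n)).mul' hWb (r := ⊤)).integrable le_top
  have h := hD.integral_mul_recall hpqr (T := awayFrom n k) (i := .rowPick n k)
    (j := .rowCoin n k) (by simp [awayFrom]) (by simp [awayFrom]) (by simp) rfl rfl hmn
    (hD.rowPick_law n k hn hk hkn) (hD.rowCoin_law n k hn hk hkn) (V := D.moved)
    (fun i _ => (D.measurable_moved (le_refl i)).mono
      (D.sigma_mono (past_subset_awayFrom i n k)) le_rfl)
    (fun i _ => hD.memLp_moved hpqr i) hW hWb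
  simp only [← D.moves_eq] at h
  simp only [Drivers.rowFluct, mul_sub, mul_left_comm (W _)]
  rw [integral_sub i1 (i2.const_mul _), integral_const_mul, ← h, sub_eq_zero]
  simp_rw [D.rowStep_sq hk]
  rfl

/-- The fluctuation at `l` depends only on the walk and on the labels of entry `l`, all of which lie
in `awayFrom n k`; the one at `k` is centred given these. -/
lemma Drivers.HasLaw.integral_rowFluct_mul (hD : D.HasLaw μ s p q r m) (hpqr : p + q + r = 1)
    (hn : 1 ≤ n) (hmn : 1 ≤ m n) (hk : m n < k) (hkn : k ≤ n) {l : ℕ} (hl : m n < l) (hln : l ≤ n)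
    (hlk : l ≠ k) :
    ∫ ω, D.rowFluct m (1 - r) n l ω * D.rowFluct m (1 - r) n k ω ∂μ = 0 := by
  refine hD.integral_mul_rowFluct hpqr hn hmn hk hkn ?_ (hD.memLp_rowFluct hpqr hn hl hln _)
  refine Measurable.sub (D.measurable_rowStep_sq (fun j => past_subset_awayFrom j n k)
    (by simpa [awayFrom] using hlk) (by simpa [awayFrom] using hlk) hl) ?_
  exact Measurable.const_mul ((D.measurable_moves (m n)).mono
    (D.sigma_mono (past_subset_awayFrom _ n k)) le_rfl) _

/-- The variance of an indicator is at most its mean. Write `Z = A + F` with `Z` the indicator of a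
move, `A` its conditional mean and `F` the fluctuation. Since `Z² = Z`, one has `Z - F² = A² + 2AF`,
and the last term integrates to `0`. -/
lemma Drivers.HasLaw.integral_rowFluct_sq_le (hD : D.HasLaw μ s p q r m) (hpqr : p + q + r = 1)
    (hn : 1 ≤ n) (hmn : 1 ≤ m n) (hk : m n < k) (hkn : k ≤ n) :
    ∫ ω, D.rowFluct m (1 - r) n k ω ^ 2 ∂μ ≤ (1 - r) / m n * ∫ ω, (D.moves (m n) ω : ℝ) ∂μ := by
  have hf := hD.memLp_rowFluct hpqr hn hk hkn (1 - r)
  have hM := hD.memLp_moves hpqr (m n)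
  have hmeas : Measurable[D.sigma (awayFrom n k)] fun ω => (1 - r) / m n * (D.moves (m n) ω : ℝ) :=
    Measurable.const_mul ((D.measurable_moves (m n)).mono
      (D.sigma_mono (past_subset_awayFrom _ n k)) le_rfl) _
  have e1 := hD.integral_mul_rowFluct hpqr hn hmn hk hkn hmeas (hM.const_mul _)
  have e2 := hD.integral_mul_rowFluct hpqr hn hmn hk hkn (W := fun _ => 1) measurable_const
    (memLp_const 1)
  have iZ := (hD.memLp_rowStep_sq hpqr hn hk hkn).integrable le_top
  have iA : Integrable (fun ω => (1 - r) / m n * (D.moves (m n) ω : ℝ)) μ :=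
    (hM.integrable le_top).const_mul _
  have iAf : Integrable
      (fun ω => (1 - r) / m n * (D.moves (m n) ω : ℝ) * D.rowFluct m (1 - r) n k ω) μ :=
    (hf.mul' (hM.const_mul ((1 - r) / (m n : ℝ))) (r := ⊤)).integrable le_top
  have hZ : ∫ ω, (D.rowStep m n ω k : ℝ) ^ 2 ∂μ =
      (1 - r) / m n * ∫ ω, (D.moves (m n) ω : ℝ) ∂μ := by
    simp only [one_mul, Drivers.rowFluct] at e2
    rw [integral_sub iZ iA, integral_const_mul] at e2
    linarith
  have if2 : Integrable (fun ω => D.rowFluct m (1 - r) n k ω ^ 2) μ :=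
    (hf.mono_exponent le_top).integrable_sq
  rw [← hZ, ← sub_nonneg, ← integral_sub iZ if2]
  calc (0 : ℝ) ≤ ∫ ω, ((1 - r) / m n * (D.moves (m n) ω : ℝ)) ^ 2 ∂μ :=
        integral_nonneg fun _ => sq_nonneg _
    _ = ∫ ω, ((1 - r) / m n * (D.moves (m n) ω : ℝ)) ^ 2 ∂μ + 2 *
        ∫ ω, (1 - r) / m n * (D.moves (m n) ω : ℝ) * D.rowFluct m (1 - r) n k ω ∂μ := by
        rw [e1]; ring
    _ = ∫ ω, ((D.rowStep m n ω k : ℝ) ^ 2 - D.rowFluct m (1 - r) n k ω ^ 2) ∂μ := by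
        rw [← integral_const_mul, ← integral_add
          ((hM.const_mul ((1 - r) / (m n : ℝ))).mono_exponent le_top).integrable_sq
          (iAf.const_mul 2)]
        refine integral_congr_ae ?_
        filter_upwards [hD.ae_rowStep_sq hpqr hn hk hkn] with ω h
        rcases h with h | h <;> simp only [Drivers.rowFluct, h] <;> ring

/-- The part of `Ξ_n` that is not explained by the walk up to time `m n`. -/
noncomputable def Drivers.rowError (D : Drivers Ω) (m : ℕ → ℕ) (β : ℝ) (n : ℕ) (ω : Ω) : ℝ :=
  ∑ k ∈ Finset.Ioc (m n) n, D.rowFluct m β n k ω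

omit [MeasurableSpace Ω] in
lemma Drivers.rowMoves_eq (hmn : m n ≤ n) (β : ℝ) (ω : Ω) :
    (D.rowMoves m n ω : ℝ) =
      (1 + β * (n - m n) / m n) * D.moves (m n) ω + D.rowError m β n ω := by
  have h1 : ∑ k ∈ Finset.Ioc 0 (m n), (D.rowStep m n ω k : ℝ) ^ 2 = D.moves (m n) ω := by
    rw [D.moves_eq]
    refine Finset.sum_congr rfl fun k hk => ?_
    rw [Drivers.rowStep, if_pos (Finset.mem_Icc.1 hk).2, Drivers.moved]
  have h2 : (D.rowMoves m n ω : ℝ) = ∑ k ∈ Finset.Ioc 0 n, (D.rowStep m n ω k : ℝ) ^ 2 := by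
    simp only [Drivers.rowMoves, Int.cast_sum, Int.cast_pow]
    rfl
  rw [h2, ← Finset.sum_Ioc_consecutive _ (Nat.zero_le _) hmn, h1, Drivers.rowError]
  simp only [Drivers.rowFluct, Finset.sum_sub_distrib, Finset.sum_const, Nat.card_Ioc,
    nsmul_eq_mul, Nat.cast_sub hmn]
  ring

lemma Drivers.HasLaw.memLp_rowError (hD : D.HasLaw μ s p q r m) (hpqr : p + q + r = 1)
    (hn : 1 ≤ n) (β : ℝ) : MemLp (D.rowError m β n) ⊤ μ :=
  memLp_finsetSum _ fun _ hk =>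
    hD.memLp_rowFluct hpqr hn (Finset.mem_Ioc.1 hk).1 (Finset.mem_Ioc.1 hk).2 β

lemma Drivers.HasLaw.integral_rowError_sq_le (hD : D.HasLaw μ s p q r m) (hpqr : p + q + r = 1)
    (hn : 1 ≤ n) (hm1 : 1 ≤ m n) (hmn : m n ≤ n) :
    ∫ ω, D.rowError m (1 - r) n ω ^ 2 ∂μ ≤
      (n - m n) * ((1 - r) / m n * growth (1 - r) (m n - 1)) := by
  have hint : ∀ k ∈ Finset.Ioc (m n) n, ∀ l ∈ Finset.Ioc (m n) n,
      Integrable (fun ω => D.rowFluct m (1 - r) n k ω * D.rowFluct m (1 - r) n l ω) μ := by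
    intro k hk l hl
    rw [Finset.mem_Ioc] at hk hl
    exact ((hD.memLp_rowFluct hpqr hn hl.1 hl.2 _).mul'
      (hD.memLp_rowFluct hpqr hn hk.1 hk.2 _) (r := ⊤)).integrable le_top
  simp only [Drivers.rowError, sq, Finset.sum_mul_sum]
  rw [integral_finsetSum _ fun k hk => integrable_finsetSum _ fun l hl => hint k hk l hl]
  have hE : ∫ ω, (D.moves (m n) ω : ℝ) ∂μ = growth (1 - r) (m n - 1) := by
    rw [← hD.integral_moves hpqr, Nat.sub_add_cancel hm1]
  calc _ ≤ ∑ k ∈ Finset.Ioc (m n) n, (1 - r) / m n * growth (1 - r) (m n - 1) := by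
        refine Finset.sum_le_sum fun k hk => ?_
        rw [integral_finsetSum _ fun l hl => hint k hk l hl, Finset.sum_eq_single_of_mem k hk]
        · simp only [← sq]
          rw [← hE]
          rw [Finset.mem_Ioc] at hk
          exact hD.integral_rowFluct_sq_le hpqr hn hm1 hk.1 hk.2
        · intro l hl hlk
          rw [Finset.mem_Ioc] at hk hl
          exact hD.integral_rowFluct_mul hpqr hn hm1 hl.1 hl.2 hk.1 hk.2 hlk.symm
    _ = _ := by simp [Nat.cast_sub hmn]

lemma Drivers.HasLaw.tendsto_rowError (hD : D.HasLaw μ s p q r m) (hpqr : p + q + r = 1)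
    (hr1 : r < 1) (hm : ∀ n, 1 ≤ n → 1 ≤ m n ∧ m n ≤ n) (hm_top : Tendsto m atTop atTop) :
    TendstoInL2 μ
      (fun n ω => (m n : ℝ) / n / (m n : ℝ) ^ (1 - r) * D.rowError m (1 - r) n ω) 0 := by
  have hmem : ∀ n, MemLp
      (fun ω => (m n : ℝ) / n / (m n : ℝ) ^ (1 - r) * D.rowError m (1 - r) n ω) 2 μ := by
    intro n
    -- No law is assumed for row `0`, but there the prefactor is a division by zero and vanishes.
    rcases Nat.eq_zero_or_pos n with rfl | hn
    · simp
    · exact ((hD.memLp_rowError hpqr hn _).const_mul _).mono_exponent le_top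
  refine tendstoInL2_of_integral_sq hmem MemLp.zero ?_
  have hβ := sub_pos.2 hr1
  -- This bounds the normalized second moment at `j = m n`: the squared prefactor times the variance
  -- bound equals it up to the factor `m n * (n - m n) / n ^ 2 ≤ 1`.
  have h1 : Tendsto (fun j : ℕ => (1 - r) * (growth (1 - r) (j - 1) / (j : ℝ) ^ (1 - r)) *
      ((j : ℝ) ^ (1 - r))⁻¹) atTop (𝓝 0) := by
    have hg : Tendsto (fun j : ℕ => growth (1 - r) (j - 1) / (j : ℝ) ^ (1 - r)) atTop
        (𝓝 (1 / ((1 - r) * Real.Gamma (1 - r)))) := by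
      rw [← tendsto_add_atTop_iff_nat 1]
      exact growth_tendsto hβ
    have hp := ((tendsto_rpow_atTop hβ).comp tendsto_natCast_atTop_atTop).inv_tendsto_atTop
    simpa using (hg.const_mul (1 - r)).mul hp
  refine tendsto_of_tendsto_of_tendsto_of_le_of_le' tendsto_const_nhds (h1.comp hm_top)
    (Eventually.of_forall fun n => integral_nonneg fun _ => sq_nonneg _) ?_
  filter_upwards [eventually_ge_atTop 1] with n hn
  obtain ⟨hm1, hmn⟩ := hm n hn
  have hE := hD.integral_rowError_sq_le hpqr hn hm1 hmn
  have hm0 : (0 : ℝ) < m n := by exact_mod_cast hm1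
  have hn0 : (0 : ℝ) < n := by exact_mod_cast hn
  have hmn' : (m n : ℝ) ≤ n := by exact_mod_cast hmn
  have hx : 0 < (m n : ℝ) ^ (1 - r) := Real.rpow_pos_of_pos hm0 _
  have hg := growth_pos hβ.le (m n - 1)
  simp only [Pi.zero_apply, sub_zero, mul_pow, Function.comp_apply]
  rw [integral_const_mul]
  refine (mul_le_mul_of_nonneg_left hE (by positivity)).trans ?_
  have hratio : (m n : ℝ) * (n - m n) / (n : ℝ) ^ 2 ≤ 1 := by
    rw [div_le_one (by positivity)]
    nlinarith
  calc _ = ((m n : ℝ) * (n - m n) / (n : ℝ) ^ 2) *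
        ((1 - r) * (growth (1 - r) (m n - 1) / (m n : ℝ) ^ (1 - r)) *
          ((m n : ℝ) ^ (1 - r))⁻¹) := by field_simp
    _ ≤ _ := mul_le_of_le_one_left (by positivity) hratio

end row

end ERWStops

theorem theorem5p2 {Ω : Type*} [MeasurableSpace Ω] (μ : Measure Ω) [IsProbabilityMeasure μ]
    (s p q r : ℝ) (hs0 : 0 ≤ s) (hs1 : s ≤ 1) (hp : 0 ≤ p) (hq : 0 ≤ q) (hr0 : 0 < r) (hr1 : r < 1)
    (hpqr : p + q + r = 1)
    (m : ℕ → ℕ) (hm : ∀ n, 1 ≤ n → 1 ≤ m n ∧ m n ≤ n) (hm_top : Tendsto m atTop atTop)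
    (γ : ℝ) (hγ : Tendsto (fun n : ℕ => (m n : ℝ) / (n : ℝ)) atTop (𝓝 γ))
    (D : ERWStops.Drivers Ω) (hD : D.HasLaw μ s p q r m)
    (β : ℝ) (hβ : β = 1 - r) :
    ∃ S : Ω → ℝ,
      (∀ᵐ ω ∂μ, Tendsto (fun n : ℕ => (D.moves n ω : ℝ) / (n : ℝ) ^ β) atTop (𝓝 (S ω))) ∧
      ERWStops.TendstoInL2 μ (fun n ω => (D.moves n ω : ℝ) / (n : ℝ) ^ β) S ∧
      ERWStops.TendstoInL2 μ
        (fun n ω => ((m n : ℝ) / (n : ℝ)) * (D.rowMoves m n ω : ℝ) / (m n : ℝ) ^ β)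
        (fun ω => (γ + β * (1 - γ)) * S ω) := by
  subst hβ
  obtain ⟨S, hae, hL2⟩ := hD.exists_tendsto_moves hpqr hr1
  refine ⟨S, hae, hL2, ?_⟩
  -- For `n ≥ 1` the coefficient is `γ_n + β (1 - γ_n)` with `γ_n = m n / n`, so no division by `γ`
  -- occurs and `γ = 0` is allowed.
  have hc : Tendsto (fun n : ℕ => (m n : ℝ) / n * (1 + (1 - r) * (n - m n) / m n)) atTop
      (𝓝 (γ + (1 - r) * (1 - γ))) := by
    refine (hγ.add ((hγ.const_sub 1).const_mul (1 - r))).congr' ?_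
    filter_upwards [eventually_ge_atTop 1] with n hn
    have hm0 : (m n : ℝ) ≠ 0 := by have := (hm n hn).1; positivity
    have hn0 : (n : ℝ) ≠ 0 := by positivity
    field_simp
  have h := ((hL2.comp hm_top).const_mul hc).add (hD.tendsto_rowError hpqr hr1 hm hm_top)
  convert h using 1
  · ext n ω
    rcases Nat.eq_zero_or_pos n with rfl | hn
    · simp
    · rw [ERWStops.Drivers.rowMoves_eq (hm n hn).2 (1 - r)]
      ring
  · ext ω
    simp
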